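/- Fix a field $F$ and an integer $r\ge 0$. A weighted graph $(G,f)$ is a finite simple graph $G=(V,E)$ with a function $f:E\to\mathbb R$. Write $N_H(v)$ for the set consisting of $v$ and its neighbors in a graph $H$, and, for $t\in\mathbb R$, $G_t$ for the subgraph of $G$ induced by the edges $e$ with $f(e)\le t$ (its vertices are the endpoints of these edges). A set $Y$ of vertices of a graph $H$ is enclaveless in $H$ if $N_H(v)\subseteq Y$ for no $v\in Y$. Consider three simplicial complexes: $Cl(G)$, the nonempty cliques of $G$; $Nb(G)$, the nonempty subsets of the sets $N_G(v)$, $v\in V$; $El(G)$, the nonempty enclaveless sets of $G$. Filtering functions $f_K:K(G)\to\mathbb R\cup\{+\infty\}$ for $K=Cl,Nb,El$ are defined as follows. For a $0$-simplex, $f_K(\langle v\rangle)$ is the minimum of $f$ on the edges incident on $v$ ($+\infty$ if there is none). For a simplex $\sigma$ with at least two vertices, $f_{Cl}(\sigma)$ is the maximum of $f$ on the edges joining vertices of $\sigma$; $f_{Nb}(\sigma)$ is the smallest $t$ such that $\sigma\subseteq N_{G_t}(w)$ for some vertex $w$ of $G_t$; $f_{El}(\sigma)$ is the smallest $t$ such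 that $\sigma$ is contained in an enclaveless set of $G_t$. For a filtered complex $(X,g)$, with sublevel complexes $X_u=\{\sigma : g(\sigma)\le u\}$, $u\in\mathbb R$, let $\beta(u,v)=\dim\operatorname{Im}\big(H_r(X_u;F)\to H_r(X_v;F)\big)$ for $u<v$ (simplicial homology). The $r$-th persistence diagram of $(X,g)$ is the multiset consisting of - each point $(u,v)$ with $u<v$ real, with multiplicity $\min\{\beta(u+\varepsilon,v-\varepsilon)-\beta(u-\varepsilon,v-\varepsilon)-\beta(u+\varepsilon,v+\varepsilon)+\beta(u-\varepsilon,v+\varepsilon) : \varepsilon>0,\ u+\varepsilon<v-\varepsilon\}$; - each point at infinity $(u,\infty)$, with multiplicity $\min\{\beta(u+\varepsilon,1/\varepsilon)-\beta(u-\varepsilon,1/\varepsilon) : \varepsilon>0,\ u+\varepsilon<1/\varepsilon\}$; - each diagonal point $(u,u)$, with countably infinite multiplicity. The bottleneck distance of two such diagrams is $d(D,D')=\inf_\sigma\sup_{P\in D}\hat d(P,\sigma(P))$, where $\sigma$ varies among all bijections $D\to D'$ (counting multiplicities) and $$\hat d((u,v),(u',v'))=\min\Big\{\max\{|u-u'|,|v-v'|\},\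 \max\big\{\tfrac{v-u}{2},\tfrac{v'-u'}{2}\big\}\Big\},\qquad |\infty-\infty|=0 .$$ The natural pseudodistance of weighted graphs is $\delta((G,f),(G',f'))=\min_\psi\max_{e\in E(G)}|f(e)-f'(\psi(e))|$, where $\psi$ varies among all graph isomorphisms $G\to G'$ (the maximum is $0$ if $G$ has no edges), and $\delta=+\infty$ if $G$ and $G'$ are not isomorphic. **Proposition.** Let $(G,f)$ and $(G',f')$ be weighted graphs, let $K$ be one of $Cl$, $Nb$, $El$, and let $D(f)$, $D(f')$ be the $r$-th persistence diagrams of $(K(G),f_K)$ and $(K(G'),f'_K)$. Then $$d\big(D(f),D(f')\big)\le\delta\big((G,f),(G',f')\big).$$ -/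

import Mathlib

open scoped ENNReal

noncomputable section

namespace GraphPersistence

/-! ### Filtered simplicial complexes and their persistent Betti numbers -/

/-- A filtered simplicial complex with vertices in `V`: a simplicial complex together with a
filtering function on its simplices which never decreases from a face to a larger simplex.
Its vertices are the `v` for which `{v}` is a simplex; the value of `value` outside `complex` is
irrelevant. The value `⊤` means that the simplex enters no sublevel complex. -/
structure FilteredComplex (V : Type*) where
  complex : PreAbstractSimplicialComplex V
  value : Finset V → EReal
  mono : ∀ σ ∈ complex, ∀ τ ∈ complex, τ ⊆ σ → value τ ≤ value σ

/-- The sublevel complex of all simplices with value at most `u`. -/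
def FilteredComplex.sublevel {V : Type*} (X : FilteredComplex V) (u : ℝ) :
    PreAbstractSimplicialComplex V where
  faces := {σ | σ ∈ X.complex ∧ X.value σ ≤ (u : EReal)}
  isRelLowerSet_faces := by
    rintro σ ⟨hσ, hu⟩
    refine ⟨(X.complex.isRelLowerSet_faces hσ).1, fun τ hτσ hτ => ?_⟩
    have h := (X.complex.isRelLowerSet_faces hσ).2 hτσ hτ
    exact ⟨h, (X.mono σ hσ τ h hτσ).trans hu⟩

theorem FilteredComplex.sublevel_mono {V : Type*} (X : FilteredComplex V) {u v : ℝ}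
    (h : u ≤ v) : X.sublevel u ≤ X.sublevel v :=
  fun _ hσ => ⟨hσ.1, hσ.2.trans (EReal.coe_le_coe_iff.2 h)⟩

/-- Formal `F`-linear combinations of `n`-tuples of elements of `V`. -/
def TupleSpace (F : Type*) [Field F] (V : Type*) (n : ℕ) : Type _ := (Fin n → V) →₀ F

instance (F : Type*) [Field F] (V : Type*) (n : ℕ) : AddCommGroup (TupleSpace F V n) :=
  inferInstanceAs (AddCommGroup ((Fin n → V) →₀ F))

instance (F : Type*) [Field F] (V : Type*) (n : ℕ) : Module F (TupleSpace F V n) :=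
  inferInstanceAs (Module F ((Fin n → V) →₀ F))

/-- The boundary `(v₀, …, vₙ) ↦ ∑ᵢ (-1)ⁱ (v₀, …, v̂ᵢ, …, vₙ)` on formal combinations of
tuples. -/
def boundary (F : Type*) [Field F] (V : Type*) (n : ℕ) :
    TupleSpace F V (n + 1) →ₗ[F] TupleSpace F V n :=
  Finsupp.linearCombination F (M := (Fin n → V) →₀ F)
    (fun x => ∑ i : Fin (n + 1), Finsupp.single (fun j => x (i.succAbove j)) ((-1 : F) ^ (i : ℕ)))

/-- The ordered `n`-chains of `K`: formal combinations of `(n+1)`-tuples of vertices of a common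
simplex. -/
def chains (F : Type*) [Field F] {V : Type*} (K : PreAbstractSimplicialComplex V) (n : ℕ) :
    Submodule F (TupleSpace F V (n + 1)) :=
  Finsupp.supported F F {x | ∃ σ ∈ K, ∀ i, x i ∈ σ}

/-- The `n`-cycles of `K`; every `0`-chain is a cycle. -/
def cycles (F : Type*) [Field F] {V : Type*} (K : PreAbstractSimplicialComplex V) :
    (n : ℕ) → Submodule F (TupleSpace F V (n + 1))
  | 0 => chains F K 0
  | n + 1 => chains F K (n + 1) ⊓ LinearMap.ker (boundary F V (n + 1))

/-- The `n`-boundaries of `K`. -/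
def boundaries (F : Type*) [Field F] {V : Type*} (K : PreAbstractSimplicialComplex V) (n : ℕ) :
    Submodule F (TupleSpace F V (n + 1)) :=
  (chains F K (n + 1)).map (boundary F V (n + 1))

/-- The simplicial homology `Hₙ(K; F)`, computed by the ordered chain complex. -/
abbrev Homology (F : Type*) [Field F] {V : Type*} (K : PreAbstractSimplicialComplex V) (n : ℕ) :
    Type _ :=
  cycles F K n ⧸ (boundaries F K n).submoduleOf (cycles F K n)

theorem chains_mono (F : Type*) [Field F] {V : Type*} {K L : PreAbstractSimplicialComplex V}
    (h : K ≤ L) (n : ℕ) : chains F K n ≤ chains F L n :=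
  Finsupp.supported_mono fun _ ⟨σ, hσ, hx⟩ => ⟨σ, h hσ, hx⟩

theorem cycles_mono (F : Type*) [Field F] {V : Type*} {K L : PreAbstractSimplicialComplex V}
    (h : K ≤ L) (n : ℕ) : cycles F K n ≤ cycles F L n := by
  cases n with
  | zero => exact chains_mono F h 0
  | succ n => exact inf_le_inf_right _ (chains_mono F h (n + 1))

theorem boundaries_mono (F : Type*) [Field F] {V : Type*} {K L : PreAbstractSimplicialComplex V}
    (h : K ≤ L) (n : ℕ) : boundaries F K n ≤ boundaries F L n :=
  Submodule.map_mono (chains_mono F h (n + 1))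

/-- The linear map `Hₙ(K; F) → Hₙ(L; F)` induced by the inclusion of a subcomplex `K` of `L`. -/
def homologyMap (F : Type*) [Field F] {V : Type*} {K L : PreAbstractSimplicialComplex V}
    (h : K ≤ L) (n : ℕ) : Homology F K n →ₗ[F] Homology F L n :=
  Submodule.mapQ _ _ (Submodule.inclusion (cycles_mono F h n))
    (fun _ hx => boundaries_mono F h n hx)

/-- The persistent Betti number function
`β(u, v) = dim Im (H_r(X_u) → H_r(X_v))` of a filtered complex, for `u < v` (and `0` outside this
half-plane, where it is not considered). -/
def pbn (F : Type*) [Field F] {V : Type*} (X : FilteredComplex V) (r : ℕ) (u v : ℝ) : ℕ :=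
  if h : u < v then
    Module.finrank F (LinearMap.range (homologyMap F (X.sublevel_mono h.le) r))
  else 0

/-! ### Persistence diagrams and the bottleneck distance -/

/-- The multiplicity of the proper point `(u, v)`, `u < v`: the minimum over `ε > 0` with
`u + ε < v - ε` of `β(u+ε, v-ε) - β(u-ε, v-ε) - β(u+ε, v+ε) + β(u-ε, v+ε)`. -/
def properMultiplicity (β : ℝ → ℝ → ℕ) (u v : ℝ) : ℕ :=
  sInf {m : ℕ | ∃ ε : ℝ, 0 < ε ∧ u + ε < v - ε ∧
    (m : ℤ) = (β (u + ε) (v - ε) : ℤ) - β (u - ε) (v - ε) - β (u + ε) (v + ε)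
      + β (u - ε) (v + ε)}

/-- The multiplicity of the point at infinity `(u, ∞)`, i.e. of the vertical half-line at `u`:
the minimum over `ε > 0` with `u + ε < 1/ε` of `β(u+ε, 1/ε) - β(u-ε, 1/ε)`. -/
def infiniteMultiplicity (β : ℝ → ℝ → ℕ) (u : ℝ) : ℕ :=
  sInf {m : ℕ | ∃ ε : ℝ, 0 < ε ∧ u + ε < 1 / ε ∧
    (m : ℤ) = (β (u + ε) (1 / ε) : ℤ) - β (u - ε) (1 / ε)}

open Classical in
/-- The multiplicity of a point `(u, v)`, `u ∈ ℝ`, `v ∈ [-∞, ∞]`, in the persistence diagram of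
`β`. Points of the diagonal have infinite multiplicity and points below it multiplicity `0`; the
cornerpoints, proper or at infinity, are the points above the diagonal with positive
multiplicity. -/
def multiplicity (β : ℝ → ℝ → ℕ) (p : ℝ × EReal) : ℕ∞ :=
  if p.2 = (p.1 : EReal) then ⊤
  else if p.2 = ⊤ then (infiniteMultiplicity β p.1 : ℕ∞)
  else if (p.1 : EReal) < p.2 then (properMultiplicity β p.1 p.2.toReal : ℕ∞)
  else 0

/-- The persistence diagram of `β`, completed by the diagonal, as a multiset: its elements are the
pairs `(p, k)` where `k` numbers the copies of the point `p`. -/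
def Diagram (β : ℝ → ℝ → ℕ) : Type :=
  {x : (ℝ × EReal) × ℕ // (x.2 : ℕ∞) < multiplicity β x.1}

/-- `|a - b|` for extended reals, with `|∞ - ∞| = 0`. -/
def extDist (a b : EReal) : ℝ≥0∞ :=
  open Classical in if a = b then 0 else (a - b).abs

/-- `min {max {|u - u'|, |v - v'|}, max {(v - u)/2, (v' - u')/2}}`. -/
def pointDist (p q : ℝ × EReal) : ℝ≥0∞ :=
  min (max (extDist p.1 q.1) (extDist p.2 q.2))
    (max ((p.2 - p.1).toENNReal / 2) ((q.2 - q.1).toENNReal / 2))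

/-- The bottleneck distance of the persistence diagrams of `β` and `β'`. -/
def bottleneckDist (β β' : ℝ → ℝ → ℕ) : ℝ≥0∞ :=
  ⨅ σ : Diagram β ≃ Diagram β', ⨆ P : Diagram β, pointDist P.1.1 (σ P).1.1

/-! ### Weighted graphs -/

section Graph

variable {V : Type*} (G : SimpleGraph V)

/-- The natural pseudodistance of weighted graphs; it is `∞` if the graphs are not isomorphic. -/
def naturalPseudodist {V V' : Type*} (G : SimpleGraph V) (f : G.edgeSet → ℝ)
    (G' : SimpleGraph V') (f' : G'.edgeSet → ℝ) : ℝ≥0∞ :=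
  ⨅ ψ : G ≃g G', ⨆ e : G.edgeSet, ENNReal.ofReal |f e - f' (ψ.mapEdgeSet e)|

/-- The minimum of `f` on the edges incident on `v` (`⊤` if there are none). -/
def vertexValue (f : G.edgeSet → ℝ) (v : V) : EReal :=
  ⨅ (e : G.edgeSet) (_ : v ∈ e.1), (f e : EReal)

/-- The subgraph `G_t` induced by all edges `e` with `f e ≤ t`. -/
def sublevelGraph (f : G.edgeSet → ℝ) (t : ℝ) : G.Subgraph where
  verts := {v | ∃ e : G.edgeSet, f e ≤ t ∧ v ∈ e.1}
  Adj u v := ∃ h : G.Adj u v, f ⟨s(u, v), h⟩ ≤ t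
  adj_sub := fun ⟨h, _⟩ => h
  edge_vert := fun {u v} ⟨h, ht⟩ => ⟨⟨s(u, v), h⟩, ht, Sym2.mem_mk_left u v⟩
  symm := ⟨fun u v ⟨h, ht⟩ => ⟨h.symm, by
    have : (⟨s(v, u), h.symm⟩ : G.edgeSet) = ⟨s(u, v), h⟩ := Subtype.ext Sym2.eq_swap
    rw [this]; exact ht⟩⟩

variable {G}

/-- The neighborhood of `v` in the subgraph `H`, including `v` itself. -/
def closedNeighborhood (H : G.Subgraph) (v : V) : Set V :=
  insert v (H.neighborSet v)

/-- `S` is contained in the neighborhood of some vertex of `H`. -/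
def InNeighborhood (H : G.Subgraph) (S : Set V) : Prop :=
  ∃ w ∈ H.verts, S ⊆ closedNeighborhood H w

/-- A set of vertices of `H` is enclaveless if it contains the neighborhood of none of its
members. -/
def IsEnclaveless (H : G.Subgraph) (S : Set V) : Prop :=
  S ⊆ H.verts ∧ ∀ v ∈ S, ¬ closedNeighborhood H v ⊆ S

variable (G)

/-- The complex of cliques. -/
def cliqueComplex : PreAbstractSimplicialComplex V where
  faces := {σ | σ.Nonempty ∧ G.IsClique (σ : Set V)}
  isRelLowerSet_faces := fun _ hσ =>
    ⟨hσ.1, fun _ hτσ hτ => ⟨hτ, hσ.2.subset (Finset.coe_subset.2 hτσ)⟩⟩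

/-- The complex of neighborhoods. -/
def neighborhoodComplex : PreAbstractSimplicialComplex V where
  faces := {σ | σ.Nonempty ∧ InNeighborhood (⊤ : G.Subgraph) (σ : Set V)}
  isRelLowerSet_faces := fun _ hσ => ⟨hσ.1, fun _ hτσ hτ =>
    ⟨hτ, hσ.2.imp fun _ h => ⟨h.1, (Finset.coe_subset.2 hτσ).trans h.2⟩⟩⟩

theorem IsEnclaveless.subset {G : SimpleGraph V} {H : G.Subgraph} {S T : Set V}
    (h : IsEnclaveless H S) (hTS : T ⊆ S) : IsEnclaveless H T :=
  ⟨hTS.trans h.1, fun v hv hN => h.2 v (hTS hv) (hN.trans hTS)⟩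

/-- The complex of enclaveless sets. -/
def enclavelessComplex : PreAbstractSimplicialComplex V where
  faces := {σ | σ.Nonempty ∧ IsEnclaveless (⊤ : G.Subgraph) (σ : Set V)}
  isRelLowerSet_faces := fun _ hσ =>
    ⟨hσ.1, fun _ hτσ hτ => ⟨hτ, hσ.2.subset (Finset.coe_subset.2 hτσ)⟩⟩

open Classical in
/-- The function which is `vertexValue` on `0`-simplices and `g` on simplices of positive
dimension. -/
def simplexValue (f : G.edgeSet → ℝ) (g : Finset V → EReal) (σ : Finset V) : EReal :=
  if σ.card = 1 then ⨅ v ∈ σ, vertexValue G f v else g σ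

/-- `f_Cl`: on a simplex of positive dimension, the maximum of `f` on the edges spanned by it. -/
def cliqueValue (f : G.edgeSet → ℝ) : Finset V → EReal :=
  simplexValue G f fun σ => ⨆ (e : G.edgeSet) (_ : ∀ v ∈ e.1, v ∈ σ), (f e : EReal)

/-- `f_Nb`: on a simplex of positive dimension, the smallest `t` for which it is a subset of a
neighborhood in `G_t`. -/
def neighborhoodValue (f : G.edgeSet → ℝ) : Finset V → EReal :=
  simplexValue G f fun σ =>
    ⨅ (t : ℝ) (_ : InNeighborhood (sublevelGraph G f t) (σ : Set V)), (t : EReal)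

/-- `f_El`: on a simplex of positive dimension, the smallest `t` for which it is a subset of an
enclaveless set in `G_t`. -/
def enclavelessValue (f : G.edgeSet → ℝ) : Finset V → EReal :=
  simplexValue G f fun σ =>
    ⨅ (t : ℝ) (_ : ∃ S : Set V, (σ : Set V) ⊆ S ∧ IsEnclaveless (sublevelGraph G f t) S),
      (t : EReal)

variable {G}

theorem vertexValue_le {f : G.edgeSet → ℝ} {v : V} (e : G.edgeSet) (h : v ∈ e.1) :
    vertexValue G f v ≤ (f e : EReal) :=
  iInf₂_le e h

theorem vertexValue_le_of_mem_verts {f : G.edgeSet → ℝ} {v : V} {t : ℝ}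
    (h : v ∈ (sublevelGraph G f t).verts) : vertexValue G f v ≤ (t : EReal) := by
  obtain ⟨e, he, hv⟩ := h
  exact (vertexValue_le e hv).trans (EReal.coe_le_coe_iff.2 he)

theorem simplexValue_mono {f : G.edgeSet → ℝ} {g : Finset V → EReal} {σ τ : Finset V}
    (hτ : τ.Nonempty) (hτσ : τ ⊆ σ) (hg : g τ ≤ g σ)
    (hv : 1 < σ.card → ∀ v ∈ σ, vertexValue G f v ≤ g σ) :
    simplexValue G f g τ ≤ simplexValue G f g σ := by
  classical
  have h1 := hτ.card_pos
  have h2 := Finset.card_le_card hτσ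
  unfold simplexValue
  split_ifs with hτ1 hσ1 hσ1
  · rw [Finset.eq_of_subset_of_card_le hτσ (by omega)]
  · obtain ⟨v, rfl⟩ := Finset.card_eq_one.1 hτ1
    simpa using hv (by omega) v (hτσ (by simp))
  · omega
  · exact hg

variable (G)

/-- The filtered complex `(Cl(G), f_Cl)`. -/
def cliqueFiltered (f : G.edgeSet → ℝ) : FilteredComplex V where
  complex := cliqueComplex G
  value := cliqueValue G f
  mono := fun σ hσ τ hτ hτσ => by
    refine simplexValue_mono hτ.1 hτσ
      (iSup_mono fun e => iSup_mono' fun h => ⟨fun v hv => hτσ (h v hv), le_rfl⟩) fun hc v hv => ?_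
    obtain ⟨w, hw, hne⟩ := Finset.exists_mem_ne hc v
    have hadj : G.Adj v w := hσ.2 hv hw hne.symm
    refine (vertexValue_le ⟨s(v, w), hadj⟩ (Sym2.mem_mk_left v w)).trans ?_
    refine le_iSup₂_of_le (⟨s(v, w), hadj⟩ : G.edgeSet) (fun x hx => ?_) le_rfl
    rcases Sym2.mem_iff.1 hx with rfl | rfl <;> assumption

/-- The filtered complex `(Nb(G), f_Nb)`. -/
def neighborhoodFiltered (f : G.edgeSet → ℝ) : FilteredComplex V where
  complex := neighborhoodComplex G
  value := neighborhoodValue G f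
  mono := fun σ hσ τ hτ hτσ => by
    refine simplexValue_mono hτ.1 hτσ (iInf_mono fun t => iInf_mono' fun h =>
      ⟨h.imp fun _ h => ⟨h.1, (Finset.coe_subset.2 hτσ).trans h.2⟩, le_rfl⟩) fun hc v hv => ?_
    refine le_iInf₂ fun t ⟨w, hw, hs⟩ => vertexValue_le_of_mem_verts ?_
    rcases hs hv with rfl | h
    · exact hw
    · exact (sublevelGraph G f t).edge_vert h.symm

/-- The filtered complex `(El(G), f_El)`. -/
def enclavelessFiltered (f : G.edgeSet → ℝ) : FilteredComplex V where
  complex := enclavelessComplex G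
  value := enclavelessValue G f
  mono := fun σ hσ τ hτ hτσ => by
    refine simplexValue_mono hτ.1 hτσ (iInf_mono fun t => iInf_mono' fun h =>
      ⟨h.imp fun _ h => ⟨(Finset.coe_subset.2 hτσ).trans h.1, h.2⟩, le_rfl⟩) fun hc v hv => ?_
    exact le_iInf₂ fun t ⟨S, hs, hS⟩ => vertexValue_le_of_mem_verts (hS.1 (hs hv))

end Graph

end GraphPersistence

end

/-!
The persistent Betti numbers of a complex are the ranks `ρ A B` of a rank function on sets of
simplices, evaluated at the sublevel sets of the filtering function `g`. If `g ∘ e` is monotone for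
an enumeration `e` of the simplices, then the bars of the diagram are pairs of indices in this
enumeration, and only the values of `g` at these indices depend on `g`. Every `g'` near `g` can be
sorted by an enumeration which also sorts `g`, because a sufficiently small perturbation can break
ties but cannot reverse a strict inequality. So the two diagrams have common bars, whose endpoints
move by at most `sup |g - g'|`, and the diagram is a locally `1`-Lipschitz function of `g`. By the
triangle inequality it is `1`-Lipschitz along segments, hence on the whole space of filtering
functions; here `g` does not have to be monotone under inclusion, since `ρ` is defined on all sets
of simplices, by way of the complexes they generate.

An isomorphism `ψ` of graphs with `|f - f' ∘ ψ| ≤ c` maps the edges of `G_t` to edges of `G'_{t+c}`,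
and similarly for its inverse. This makes the complexes of `G` and `G'` isomorphic with filtering
functions at distance at most `c`.
-/

noncomputable section

namespace GraphPersistence

open scoped NNReal

/-! ### Rank functions and their bars -/

section RelRank

open Module

variable {F : Type*} [Field F] {M M' : Type*} [AddCommGroup M] [Module F M] [AddCommGroup M']
  [Module F M'] {Z Z' B B' : Submodule F M}

variable (F) in
/-- The dimension of the image of the subspace `Z` in the quotient by the subspace `B`; neither
needs to contain the other. For cycles `Z` and boundaries `B` it is the rank of a map in
persistent homology. -/
def relRank (Z B : Submodule F M) : ℕ :=
  finrank F (Z ⧸ B.submoduleOf Z)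

theorem relRank_map {φ : M →ₗ[F] M'} (hφ : Function.Injective φ) (Z B : Submodule F M) :
    relRank F (Z.map φ) (B.map φ) = relRank F Z B := by
  refine (Submodule.Quotient.equiv _ _ (Submodule.equivMapOfInjective φ hφ Z) ?_).finrank_eq.symm
  ext ⟨y, z, hz, rfl⟩
  simp only [Submodule.mem_map, Submodule.submoduleOf, Submodule.mem_comap, Submodule.subtype_apply,
    Subtype.exists, Subtype.ext_iff]
  constructor
  · rintro ⟨x, hx, hxB, hxz⟩
    exact ⟨x, hxB, hxz⟩
  · rintro ⟨x, hxB, hxz⟩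
    exact ⟨x, hφ hxz ▸ hz, hxB, hxz⟩

theorem relRank_bot_left (B : Submodule F M) : relRank F ⊥ B = 0 :=
  finrank_zero_of_subsingleton

theorem relRank_top_right (Z : Submodule F M) : relRank F Z ⊤ = 0 :=
  have : Subsingleton (Z ⧸ (⊤ : Submodule F M).submoduleOf Z) :=
    Submodule.Quotient.subsingleton_iff.2 (Submodule.comap_top _)
  finrank_zero_of_subsingleton

variable [Module.Finite F M]

theorem relRank_add_finrank_inf (Z B : Submodule F M) :
    relRank F Z B + finrank F ↥(Z ⊓ B) = finrank F Z := by
  rw [← Submodule.map_comap_subtype, Submodule.finrank_map_subtype_eq]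
  exact Submodule.finrank_quotient_add_finrank _

theorem relRank_add_relRank_le (hZ : Z ≤ Z') (hB : B ≤ B') :
    relRank F Z' B' + relRank F Z B ≤ relRank F Z' B + relRank F Z B' := by
  have hsup : Z' ⊓ B ⊔ Z ⊓ B' ≤ Z' ⊓ B' :=
    sup_le (inf_le_inf_left _ hB) (inf_le_inf_right _ hZ)
  have hinf : Z' ⊓ B ⊓ (Z ⊓ B') ≤ Z ⊓ B :=
    le_inf (inf_le_right.trans inf_le_left) (inf_le_left.trans inf_le_right)
  have := Submodule.finrank_sup_add_finrank_inf_eq (Z' ⊓ B) (Z ⊓ B')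
  have := Submodule.finrank_mono hsup
  have := Submodule.finrank_mono hinf
  have := relRank_add_finrank_inf Z B
  have := relRank_add_finrank_inf Z B'
  have := relRank_add_finrank_inf Z' B
  have := relRank_add_finrank_inf Z' B'
  lia

theorem relRank_mono_left (hZ : Z ≤ Z') (B : Submodule F M) : relRank F Z B ≤ relRank F Z' B := by
  simpa [relRank_top_right] using relRank_add_relRank_le hZ (le_top : B ≤ ⊤)

end RelRank

section RankFunction

open Finset

/-- The properties of the rank `ρ a b` of a map `H(a) → H(b)`, for stages `a` and `b` of a
filtration indexed by `α`, on which persistence diagrams rest. The last one says that the number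
of classes which are born between `a` and `a'` and die between `b` and `b'` is not negative. -/
structure IsRankFunction {α : Type*} [Preorder α] [OrderBot α] (ρ : α → α → ℕ) : Prop where
  bot_left : ∀ b, ρ ⊥ b = 0
  mono_left : ∀ ⦃a a'⦄, a ≤ a' → ∀ b, ρ a b ≤ ρ a' b
  add_le_add : ∀ ⦃a a'⦄, a ≤ a' → ∀ ⦃b b'⦄, b ≤ b' → ρ a' b' + ρ a b ≤ ρ a' b + ρ a b'

theorem sum_range_sum_Ico_sub (s : ℕ → ℕ → ℤ) (a : ℕ) {b c : ℕ} (hbc : b ≤ c) :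
    ∑ i ∈ range a, ∑ j ∈ Ico b c, (s (i + 1) j - s i j - s (i + 1) (j + 1) + s i (j + 1)) =
      s a b - s 0 b - (s a c - s 0 c) := by
  have hrow (i : ℕ) :
      ∑ j ∈ Ico b c, (s (i + 1) j - s i j - s (i + 1) (j + 1) + s i (j + 1)) =
        s (i + 1) b - s i b - (s (i + 1) c - s i c) := by
    rw [← neg_inj, neg_sub, ← sum_Ico_sub (fun j => s (i + 1) j - s i j) hbc, ← sum_neg_distrib]
    exact sum_congr rfl fun j _ => by ring
  simp only [hrow, sum_sub_distrib, sum_range_sub (s · b), sum_range_sub (s · c)]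

open Classical in
theorem exists_bars_of_multiplicity_nonneg (s : ℕ → ℕ → ℤ) (N : ℕ) (hbirth : ∀ j, s 0 j = 0)
    (hdeath : ∀ i, s i (N + 1) = 0)
    (hmult : ∀ i j, 0 ≤ s (i + 1) j - s i j - s (i + 1) (j + 1) + s i (j + 1)) :
    ∃ (ι : Type) (_ : Fintype ι) (p : ι → Fin N) (q : ι → ℕ), (∀ x, p x < q x) ∧
      ∀ a b, a ≤ b → b ≤ N → s a b = #{x | p x < a ∧ b ≤ q x} := by
  let m (y : ℕ × ℕ) : ℕ :=
    (s (y.1 + 1) y.2 - s y.1 y.2 - s (y.1 + 1) (y.2 + 1) + s y.1 (y.2 + 1)).toNat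
  let bars : Finset (Σ _ : ℕ × ℕ, ℕ) :=
    {y ∈ range N ×ˢ range (N + 1) | y.1 < y.2}.sigma fun y => range (m y)
  have hbars (x : bars) : x.1.1.1 < N ∧ x.1.1.1 < x.1.1.2 := by
    have := mem_sigma.1 x.2
    simp_all
  refine ⟨bars, inferInstance, fun x => ⟨x.1.1.1, (hbars x).1⟩, fun x => x.1.1.2,
    fun x => (hbars x).2, fun a b hab hb => ?_⟩
  have halive : {x ∈ bars | x.1.1 < a ∧ b ≤ x.1.2} =
      (range a ×ˢ Ico b (N + 1)).sigma fun y => range (m y) := by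
    ext ⟨⟨i, j⟩, k⟩
    simp only [bars, mem_filter, mem_sigma, mem_product, mem_range, mem_Ico]
    lia
  calc s a b
      = ∑ y ∈ range a ×ˢ Ico b (N + 1), (m y : ℤ) := by
        simp only [m, Int.toNat_of_nonneg (hmult _ _), sum_product,
          sum_range_sum_Ico_sub s a (hb.trans N.le_succ), hbirth, hdeath, sub_zero]
    _ = #{x ∈ bars | x.1.1 < a ∧ b ≤ x.1.2} := by simp [halive]
    _ = _ := by simp [filter_attach fun x : Σ _ : ℕ × ℕ, ℕ => x.1.1 < a ∧ b ≤ x.1.2]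

variable {α : Type*} [Preorder α] [OrderBot α] {ρ : α → α → ℕ}

open Classical in
theorem IsRankFunction.exists_bars (hρ : IsRankFunction ρ) {A : ℕ → α} (hA : Monotone A)
    (hA0 : A 0 = ⊥) (N : ℕ) :
    ∃ (ι : Type) (_ : Fintype ι) (p : ι → Fin N) (q : ι → ℕ), (∀ x, p x < q x) ∧
      ∀ a b, a ≤ b → b ≤ N → ρ (A a) (A b) = #{x | p x < a ∧ b ≤ q x} := by
  obtain ⟨ι, hι, p, q, hpq, hcount⟩ :=
    exists_bars_of_multiplicity_nonneg (fun i j => if j ≤ N then (ρ (A i) (A j) : ℤ) else 0) N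
      (by simp [hA0, hρ.bot_left]) (by simp) fun i j => by
        rcases lt_trichotomy j N with hj | rfl | hj
        · have := hρ.add_le_add (hA i.le_succ) (hA j.le_succ)
          simp only [hj.le, Nat.succ_le_of_lt hj, if_true]
          lia
        · simpa using hρ.mono_left (hA i.le_succ) (A j)
        · simp [hj.not_ge, (hj.trans j.lt_succ_self).not_ge]
  refine ⟨ι, hι, p, q, hpq, fun a b hab hb => ?_⟩
  simpa [hb] using hcount a b hab hb

end RankFunction

/-! ### The persistence diagram of a barcode -/

section Barcode

open Finset Filter Topology

open Classical in
/-- The function `β` counts the intervals `[b x, d x)` which contain both of its arguments. These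
intervals are the bars; a bar with `d x = ⊤` never dies. -/
structure IsBarcode {ι : Type*} [Fintype ι] (β : ℝ → ℝ → ℕ) (b : ι → ℝ) (d : ι → EReal) :
    Prop where
  birth_le_death : ∀ x, (b x : EReal) ≤ d x
  eq_card : ∀ ⦃u v : ℝ⦄, u < v → β u v = #{x | b x ≤ u ∧ (v : EReal) < d x}

namespace IsBarcode

variable {ι : Type*} [Fintype ι] {β : ℝ → ℝ → ℕ} {b : ι → ℝ} {d : ι → EReal}

open Classical in
theorem sub_eq_card (h : IsBarcode β b d) {u u' v : ℝ} (hu : u ≤ u') (huv : u' < v) :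
    (β u' v : ℤ) - β u v = #{x | b x ∈ Set.Ioc u u' ∧ (v : EReal) < d x} := by
  rw [h.eq_card huv, h.eq_card (hu.trans_lt huv)]
  simp only [card_filter, Nat.cast_sum, ← sum_sub_distrib]
  exact sum_congr rfl fun x _ => by grind

open Classical in
theorem sub_sub_add_eq_card (h : IsBarcode β b d) {u u' v v' : ℝ} (hu : u ≤ u') (huv : u' < v)
    (hv : v ≤ v') :
    (β u' v : ℤ) - β u v - β u' v' + β u v' =
      #{x | b x ∈ Set.Ioc u u' ∧ d x ∈ Set.Ioc (v : EReal) v'} := by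
  have hv' : (v : EReal) ≤ v' := EReal.coe_le_coe_iff.2 hv
  rw [sub_add, h.sub_eq_card hu huv, h.sub_eq_card hu (huv.trans_le hv)]
  simp only [card_filter, Nat.cast_sum, ← sum_sub_distrib]
  exact sum_congr rfl fun x _ => by grind

end IsBarcode

theorem eventually_eq_of_mem_Ioc (a u : ℝ) :
    ∀ᶠ ε in 𝓝[>] (0 : ℝ), a ∈ Set.Ioc (u - ε) (u + ε) → a = u := by
  rcases eq_or_ne a u with rfl | h
  · simp
  · filter_upwards [nhdsWithin_le_nhds (Iio_mem_nhds (abs_pos.2 (sub_ne_zero.2 h)))]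
      with ε hε ⟨hlt, hle⟩
    grind

theorem eventually_eq_of_mem_Ioc_coe (a : EReal) (v : ℝ) :
    ∀ᶠ ε in 𝓝[>] (0 : ℝ), a ∈ Set.Ioc ((v - ε : ℝ) : EReal) (v + ε : ℝ) → a = v := by
  induction a with
  | bot => simp
  | top => exact Eventually.of_forall fun ε h => absurd h.2 (EReal.coe_lt_top _).not_ge
  | coe a => simpa only [Set.mem_Ioc, EReal.coe_lt_coe_iff, EReal.coe_le_coe_iff,
      EReal.coe_eq_coe_iff] using eventually_eq_of_mem_Ioc a v

theorem tendsto_one_div_nhdsGT_zero : Tendsto (fun ε : ℝ => 1 / ε) (𝓝[>] 0) atTop := by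
  simpa using tendsto_inv_nhdsGT_zero (𝕜 := ℝ)

theorem eventually_eq_top_of_one_div_lt (a : EReal) :
    ∀ᶠ ε in 𝓝[>] (0 : ℝ), ((1 / ε : ℝ) : EReal) < a → a = ⊤ := by
  induction a with
  | bot => simp
  | top => simp
  | coe a =>
    filter_upwards [tendsto_one_div_nhdsGT_zero.eventually_ge_atTop a] with ε hε h
    exact absurd (EReal.coe_lt_coe_iff.1 h) hε.not_gt

theorem sInf_setOf_eq_card {ι : Type*} {P : ℝ → Prop} {F : ℝ → ℤ} {S : ℝ → Finset ι}
    {T : Finset ι} (hF : ∀ ε, 0 < ε → P ε → F ε = #(S ε)) (hTS : ∀ ε, 0 < ε → P ε → T ⊆ S ε)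
    (hP : ∀ᶠ ε in 𝓝[>] 0, P ε) (hST : ∀ᶠ ε in 𝓝[>] 0, S ε ⊆ T) :
    sInf {m : ℕ | ∃ ε, 0 < ε ∧ P ε ∧ (m : ℤ) = F ε} = #T := by
  obtain ⟨ε, hε, hPε, hSε⟩ := (eventually_mem_nhdsWithin.and (hP.and hST)).exists
  refine IsLeast.csInf_eq ⟨⟨ε, hε, hPε, ?_⟩, ?_⟩
  · rw [hF ε hε hPε, (hTS ε hε hPε).antisymm hSε]
  · rintro m ⟨ε, hε, hPε, hm⟩
    rw [hF ε hε hPε, Nat.cast_inj] at hm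
    exact hm ▸ card_le_card (hTS ε hε hPε)

namespace IsBarcode

variable {ι : Type*} [Fintype ι] {β : ℝ → ℝ → ℕ} {b : ι → ℝ} {d : ι → EReal}

open Classical in
theorem properMultiplicity_eq (h : IsBarcode β b d) {u v : ℝ} (huv : u < v) :
    properMultiplicity β u v = #{x | b x = u ∧ d x = v} := by
  refine sInf_setOf_eq_card
    (S := fun ε => {x | b x ∈ Set.Ioc (u - ε) (u + ε) ∧
      d x ∈ Set.Ioc ((v - ε : ℝ) : EReal) (v + ε : ℝ)})
    (fun ε hε hlt => h.sub_sub_add_eq_card (by linarith) hlt (by linarith))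
    (fun ε hε _ => monotone_filter_right _ fun x _ => ?_) ?_ ?_
  · rintro ⟨rfl, hd⟩
    rw [hd, Set.mem_Ioc, Set.mem_Ioc, EReal.coe_lt_coe_iff, EReal.coe_le_coe_iff]
    refine ⟨⟨?_, ?_⟩, ?_, ?_⟩ <;> linarith
  · filter_upwards [nhdsWithin_le_nhds (Iio_mem_nhds (half_pos (sub_pos.2 huv)))] with ε hε
    rw [Set.mem_Iio] at hε
    linarith
  · filter_upwards [eventually_all.2 fun x => eventually_eq_of_mem_Ioc (b x) u,
      eventually_all.2 fun x => eventually_eq_of_mem_Ioc_coe (d x) v] with ε hb hd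
    exact monotone_filter_right _ fun x _ hx => ⟨hb x hx.1, hd x hx.2⟩

open Classical in
theorem infiniteMultiplicity_eq (h : IsBarcode β b d) (u : ℝ) :
    infiniteMultiplicity β u = #{x | b x = u ∧ d x = ⊤} := by
  refine sInf_setOf_eq_card
    (S := fun ε => {x | b x ∈ Set.Ioc (u - ε) (u + ε) ∧ ((1 / ε : ℝ) : EReal) < d x})
    (fun ε hε hlt => h.sub_eq_card (by linarith) hlt)
    (fun ε hε _ => monotone_filter_right _ fun x _ => ?_) ?_ ?_
  · rintro ⟨rfl, hd⟩
    exact ⟨⟨by linarith, by linarith⟩, hd ▸ EReal.coe_lt_top _⟩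
  · filter_upwards [tendsto_one_div_nhdsGT_zero.eventually_gt_atTop (u + 1),
      nhdsWithin_le_nhds (Iio_mem_nhds one_pos)] with ε hlt hε
    rw [Set.mem_Iio] at hε
    linarith
  · filter_upwards [eventually_all.2 fun x => eventually_eq_of_mem_Ioc (b x) u,
      eventually_all.2 fun x => eventually_eq_top_of_one_div_lt (d x)] with ε hb hd
    exact monotone_filter_right _ fun x _ hx => ⟨hb x hx.1, hd x hx.2⟩

open Classical in
theorem multiplicity_eq (h : IsBarcode β b d) {p : ℝ × EReal} (hp : p.2 ≠ (p.1 : EReal)) :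
    multiplicity β p = #{x | (b x, d x) = p} := by
  obtain ⟨u, v⟩ := p
  simp only [multiplicity, Prod.mk.injEq, if_neg hp]
  split_ifs with hv huv
  · rw [hv, h.infiniteMultiplicity_eq]
  · lift v to ℝ using ⟨hv, (bot_le.trans_lt huv).ne'⟩
    rw [EReal.toReal_coe, h.properMultiplicity_eq (EReal.coe_lt_coe_iff.1 huv)]
  · rw [eq_comm, Nat.cast_eq_zero, card_eq_zero, filter_eq_empty_iff]
    rintro x - ⟨rfl, rfl⟩
    exact huv ((h.birth_le_death x).lt_of_ne hp.symm)

end IsBarcode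

/-- The point of the half-plane represented by a bar or by a numbered copy of a diagonal point. -/
def barPoint {ι : Type*} (b : ι → ℝ) (d : ι → EReal) : ι ⊕ ℝ × ℕ → ℝ × EReal :=
  Sum.elim (fun x => (b x, d x)) fun y => (y.1, (y.1 : EReal))

/-- The copies of `p` in the persistence diagram of `β` are numbered by the naturals below its
multiplicity. -/
def Diagram.fiberEquiv (β : ℝ → ℝ → ℕ) (p : ℝ × EReal) :
    {x : Diagram β // x.1.1 = p} ≃ {k : ℕ // (k : ℕ∞) < multiplicity β p} where
  toFun x := ⟨x.1.1.2, by have := x.1.2; rwa [x.2] at this⟩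
  invFun k := ⟨⟨(p, k.1), k.2⟩, rfl⟩
  left_inv := by rintro ⟨⟨⟨p, k⟩, hk⟩, rfl⟩; rfl
  right_inv _ := rfl

/-- The numbered copies of a diagonal point. -/
def diagonalFiberEquiv (u : ℝ) : {y : ℝ × ℕ // (y.1, (y.1 : EReal)) = (u, (u : EReal))} ≃ ℕ where
  toFun y := y.1.2
  invFun k := ⟨(u, k), rfl⟩
  left_inv := by rintro ⟨⟨v, k⟩, hv⟩; obtain rfl : v = u := congrArg Prod.fst hv; rfl
  right_inv _ := rfl

namespace IsBarcode

variable {ι : Type*} [Fintype ι] {β : ℝ → ℝ → ℕ} {b : ι → ℝ} {d : ι → EReal}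

theorem nonempty_fiber_equiv (h : IsBarcode β b d) (p : ℝ × EReal) :
    Nonempty ({x : Diagram β // x.1.1 = p} ≃ {y // barPoint b d y = p}) := by
  classical
  let e : {y // barPoint b d y = p} ≃
      {x // (b x, d x) = p} ⊕ {y : ℝ × ℕ // (y.1, (y.1 : EReal)) = p} :=
    Equiv.subtypeSum
  by_cases hp : p.2 = (p.1 : EReal)
  · obtain ⟨u, v⟩ := p
    obtain rfl : v = u := hp
    have hlt (k : ℕ) : (k : ℕ∞) < multiplicity β (u, (u : EReal)) := by simp [multiplicity]
    have := (diagonalFiberEquiv u).countable_iff.2 inferInstance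
    have := (diagonalFiberEquiv u).infinite_iff.2 inferInstance
    obtain ⟨e'⟩ := nonempty_equiv_of_countable (α := ℕ)
      (β := {x // (b x, d x) = (u, (u : EReal))} ⊕
        {y : ℝ × ℕ // (y.1, (y.1 : EReal)) = (u, (u : EReal))})
    exact ⟨(Diagram.fiberEquiv β _).trans <| (Equiv.subtypeUnivEquiv hlt).trans (e'.trans e.symm)⟩
  · have hlt (k : ℕ) : (k : ℕ∞) < multiplicity β p ↔ k < #{x | (b x, d x) = p} := by
      rw [h.multiplicity_eq hp, Nat.cast_lt]
    have : IsEmpty {y : ℝ × ℕ // (y.1, (y.1 : EReal)) = p} := ⟨fun y => hp (by rw [← y.2])⟩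
    exact ⟨(Diagram.fiberEquiv β p).trans <| (Equiv.subtypeEquivRight hlt).trans <|
      Fin.equivSubtype.symm.trans <|
      (Fintype.equivFinOfCardEq (Fintype.card_subtype _)).symm.trans <|
      (Equiv.sumEmpty _ _).symm.trans e.symm⟩

theorem exists_equiv (h : IsBarcode β b d) :
    ∃ e : Diagram β ≃ ι ⊕ ℝ × ℕ, ∀ x, barPoint b d (e x) = x.1.1 := by
  have e := fun p => (h.nonempty_fiber_equiv p).some
  refine ⟨(Equiv.sigmaFiberEquiv fun x : Diagram β => x.1.1).symm.trans
    ((Equiv.sigmaCongrRight e).trans (Equiv.sigmaFiberEquiv (barPoint b d))), fun x => ?_⟩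
  exact (e x.1.1 ⟨x, rfl⟩).2

end IsBarcode

end Barcode

/-! ### The bottleneck distance -/

theorem extDist_le_coe_iff {a b : EReal} {r : ℝ≥0} :
    extDist a b ≤ r ↔ a ≤ b + (r : ℝ) ∧ b ≤ a + (r : ℝ) := by
  have hr : (0 : EReal) ≤ (r : ℝ) := EReal.coe_nonneg.2 r.2
  unfold extDist
  split_ifs with hab
  · subst hab
    exact iff_of_true zero_le ⟨le_add_of_nonneg_right hr, le_add_of_nonneg_right hr⟩
  induction a with
  | bot => simp [Ne.symm hab]
  | top => induction b with
    | bot => simp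
    | top => exact absurd rfl hab
    | coe b => simp [← EReal.coe_add]
  | coe a => induction b with
    | bot => simp
    | top => simp [← EReal.coe_add]
    | coe b =>
      rw [← EReal.coe_sub, EReal.abs_def, ENNReal.ofReal_le_coe, abs_le, ← EReal.coe_add,
        ← EReal.coe_add, EReal.coe_le_coe_iff, EReal.coe_le_coe_iff]
      constructor <;> rintro ⟨h, h'⟩ <;> constructor <;> linarith

theorem extDist_comm (a b : EReal) : extDist a b = extDist b a := by
  have hle (a b : EReal) : extDist a b ≤ extDist b a := by
    cases h : extDist b a with
    | top => exact le_top
    | coe r => exact extDist_le_coe_iff.2 (extDist_le_coe_iff.1 h.le).symm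
  exact (hle a b).antisymm (hle b a)

theorem extDist_triangle (a b c : EReal) : extDist a c ≤ extDist a b + extDist b c := by
  cases hab : extDist a b with
  | top => simp
  | coe r =>
  cases hbc : extDist b c with
  | top => simp
  | coe s =>
  obtain ⟨ha_le_b, hb_le_a⟩ := extDist_le_coe_iff.1 hab.le
  obtain ⟨hb_le_c, hc_le_b⟩ := extDist_le_coe_iff.1 hbc.le
  rw [← ENNReal.coe_add, extDist_le_coe_iff, NNReal.coe_add, EReal.coe_add]
  constructor
  · calc a ≤ c + (s : ℝ) + (r : ℝ) := ha_le_b.trans (by gcongr)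
      _ = c + ((r : ℝ) + (s : ℝ)) := by rw [add_assoc, add_comm ((s : ℝ) : EReal)]
  · calc c ≤ a + (r : ℝ) + (s : ℝ) := hc_le_b.trans (by gcongr)
      _ = a + ((r : ℝ) + (s : ℝ)) := add_assoc _ _ _

/-- Half the persistence of a point of the diagram: its distance to the diagonal. -/
def diagonalDist (p : ℝ × EReal) : ℝ≥0∞ :=
  (p.2 - p.1).toENNReal / 2

theorem diagonalDist_le_coe_iff {p : ℝ × EReal} {r : ℝ≥0} :
    diagonalDist p ≤ r ↔ p.2 ≤ ((p.1 + 2 * r : ℝ) : EReal) := by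
  obtain ⟨u, v⟩ := p
  rw [diagonalDist, ENNReal.div_le_iff two_ne_zero ENNReal.ofNat_ne_top]
  induction v with
  | bot => simp
  | top => exact iff_of_false (by simp [ENNReal.mul_eq_top]) (EReal.coe_lt_top _).not_ge
  | coe v =>
    rw [← EReal.coe_sub, EReal.real_coe_toENNReal, EReal.coe_le_coe_iff]
    norm_cast
    rw [sub_le_iff_le_add', mul_comm]

theorem diagonalDist_le_add (p q : ℝ × EReal) :
    diagonalDist p ≤ max (extDist p.1 q.1) (extDist p.2 q.2) + diagonalDist q := by
  cases hd : max (extDist p.1 q.1) (extDist p.2 q.2) with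
  | top => simp
  | coe r =>
  cases hq : diagonalDist q with
  | top => simp
  | coe s =>
  obtain ⟨hbirth, hdeath⟩ := max_le_iff.1 hd.le
  have hbirth := (extDist_le_coe_iff.1 hbirth).2
  have hdeath := (extDist_le_coe_iff.1 hdeath).1
  have hpersistence := diagonalDist_le_coe_iff.1 hq.le
  rw [← EReal.coe_add, EReal.coe_le_coe_iff] at hbirth
  rw [← ENNReal.coe_add, diagonalDist_le_coe_iff]
  calc p.2 ≤ q.2 + (r : ℝ) := hdeath
    _ ≤ ((q.1 + 2 * s : ℝ) : EReal) + (r : ℝ) := by gcongr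
    _ ≤ ((p.1 + 2 * (r + s : ℝ≥0) : ℝ) : EReal) := by
      rw [← EReal.coe_add, EReal.coe_le_coe_iff]
      push_cast
      linarith

theorem pointDist_eq (p q : ℝ × EReal) :
    pointDist p q = min (max (extDist p.1 q.1) (extDist p.2 q.2))
      (max (diagonalDist p) (diagonalDist q)) :=
  rfl

theorem pointDist_triangle (p q s : ℝ × EReal) :
    pointDist p s ≤ pointDist p q + pointDist q s := by
  have hpq := diagonalDist_le_add p q
  have hsq := diagonalDist_le_add s q
  rw [extDist_comm s.1, extDist_comm s.2, add_comm] at hsq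
  have htri : max (extDist p.1 s.1) (extDist p.2 s.2) ≤
      max (extDist p.1 q.1) (extDist p.2 q.2) + max (extDist q.1 s.1) (extDist q.2 s.2) :=
    max_le
      ((extDist_triangle _ _ _).trans (add_le_add (le_max_left _ _) (le_max_left _ _)))
      ((extDist_triangle _ _ _).trans (add_le_add (le_max_right _ _) (le_max_right _ _)))
  rw [pointDist_eq p q, pointDist_eq q s, min_add, add_min, add_min]
  refine le_min (le_min (min_le_of_left_le htri) ?_) (le_min ?_ ?_) <;>
    refine min_le_of_right_le (max_le ?_ ?_)
  · exact hpq.trans (by gcongr; exact le_max_left _ _)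
  · exact (le_max_right _ _).trans le_add_self
  · exact (le_max_left _ _).trans le_self_add
  · exact hsq.trans (by gcongr; exact le_max_right _ _)
  · exact (le_max_left _ _).trans le_self_add
  · exact (le_max_right _ _).trans le_add_self

theorem bottleneckDist_triangle (β₁ β₂ β₃ : ℝ → ℝ → ℕ) :
    bottleneckDist β₁ β₃ ≤ bottleneckDist β₁ β₂ + bottleneckDist β₂ β₃ := by
  simp only [bottleneckDist, ENNReal.iInf_add, ENNReal.add_iInf]
  refine le_iInf₂ fun τ σ => iInf_le_of_le (σ.trans τ) (iSup_le fun P => ?_)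
  exact (pointDist_triangle _ (σ P).1.1 _).trans (add_le_add
    (le_iSup (fun P : Diagram β₁ => pointDist P.1.1 (σ P).1.1) P)
    (le_iSup (fun P : Diagram β₂ => pointDist P.1.1 (τ P).1.1) (σ P)))

theorem IsBarcode.bottleneckDist_le {ι : Type*} [Fintype ι] {β β' : ℝ → ℝ → ℕ} {b b' : ι → ℝ}
    {d d' : ι → EReal} (h : IsBarcode β b d) (h' : IsBarcode β' b' d') {r : ℝ≥0∞}
    (hr : ∀ x, pointDist (b x, d x) (b' x, d' x) ≤ r) : bottleneckDist β β' ≤ r := by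
  obtain ⟨e, he⟩ := h.exists_equiv
  obtain ⟨e', he'⟩ := h'.exists_equiv
  refine iInf_le_of_le (e.trans e'.symm) (iSup_le fun P => ?_)
  rw [← he, ← he', Equiv.trans_apply, Equiv.apply_symm_apply]
  cases e P with
  | inl x => exact hr x
  | inr y => simp [barPoint, pointDist, extDist]

/-! ### Stability under perturbation of the filtering function -/

section Stability

open Filter Finset Topology

theorem le_edist_of_eventually_le_edist {E : Type*} [SeminormedAddCommGroup E] [NormedSpace ℝ E]
    {d : E → E → ℝ≥0∞} (htri : ∀ x y z, d x z ≤ d x y + d y z)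
    (hloc : ∀ x, ∀ᶠ y in 𝓝 x, d x y ≤ edist x y ∧ d y x ≤ edist y x) (x y : E) :
    d x y ≤ edist x y := by
  let γ : ℝ → E := AffineMap.lineMap x y
  have hγ : Continuous γ := AffineMap.lineMap_continuous
  have hγ0 : γ 0 = x := AffineMap.lineMap_apply_zero x y
  have hγ1 : γ 1 = y := AffineMap.lineMap_apply_one x y
  have hadd {s t : ℝ} (hs : 0 ≤ s) (hst : s ≤ t) :
      edist x (γ s) + edist (γ s) (γ t) = edist x (γ t) := by
    rw [edist_dist, edist_dist, edist_dist, ← ENNReal.ofReal_add dist_nonneg dist_nonneg,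
      dist_left_lineMap, dist_left_lineMap, dist_lineMap_lineMap, ← add_mul, dist_comm s t,
      Real.dist_eq, abs_of_nonneg (sub_nonneg.2 hst), Real.norm_of_nonneg hs,
      Real.norm_of_nonneg (hs.trans hst), add_sub_cancel]
  have hclosed : IsClosed ({s | d x (γ s) ≤ edist x (γ s)} ∩ Set.Icc 0 1) := by
    refine IsClosed.inter (isClosed_iff_frequently.2 fun s hs => ?_) isClosed_Icc
    have hlim : Tendsto (fun t => edist x (γ t) + edist (γ t) (γ s)) (𝓝 s) (𝓝 (edist x (γ s))) :=
      Continuous.tendsto' (by fun_prop) _ _ (by simp)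
    refine ge_of_tendsto_of_frequently hlim
      ((hs.and_eventually ((hγ.tendsto s).eventually (hloc (γ s)))).mono fun t ht => ?_)
    exact (htri _ _ _).trans (add_le_add ht.1 ht.2.2)
  have hunit : Set.Icc 0 1 ⊆ {s | d x (γ s) ≤ edist x (γ s)} := by
    refine hclosed.Icc_subset_of_forall_exists_gt ?_ fun s hs t hst => ?_
    · rw [Set.mem_ofPred_eq, hγ0]
      exact (hloc x).self_of_nhds.1
    · have hnear : ∀ᶠ t' in 𝓝[>] s, d (γ s) (γ t') ≤ edist (γ s) (γ t') :=
        nhdsWithin_le_nhds (((hγ.tendsto s).eventually (hloc (γ s))).mono fun _ h => h.1)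
      obtain ⟨t', hd, ht'⟩ := (hnear.and (Ioc_mem_nhdsGT hst)).exists
      refine ⟨t', (htri x (γ s) (γ t')).trans ?_, ht'⟩
      exact (add_le_add hs.1 hd).trans_eq (hadd hs.2.1 ht'.1.le)
  simpa only [Set.mem_ofPred_eq, hγ1] using hunit (Set.right_mem_Icc.2 zero_le_one)

/-- The numbers `ρ {g ≤ u} {g ≤ v}` for `u < v`: the persistent Betti numbers of the filtration by
the sublevel sets of `g`. -/
def sublevelRank {P : Type*} (ρ : Set P → Set P → ℕ) (g : P → ℝ) (u v : ℝ) : ℕ :=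
  if u < v then ρ {x | g x ≤ u} {x | g x ≤ v} else 0

/-- The set of the first `i` elements in the enumeration `e`. -/
def initialSegment {P : Type*} {N : ℕ} (e : Fin N ≃ P) (i : ℕ) : Set P :=
  {x | e.symm x < i}

theorem initialSegment_mono {P : Type*} {N : ℕ} (e : Fin N ≃ P) : Monotone (initialSegment e) :=
  fun _ _ hij _ hx => lt_of_lt_of_le hx hij

/-- The value `f j`, with the convention that it is infinite for `j ≥ N`. -/
def levelValue {N : ℕ} (f : Fin N → ℝ) (j : ℕ) : EReal :=
  if h : j < N then f ⟨j, h⟩ else ⊤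

theorem coe_lt_levelValue_iff {N : ℕ} {f : Fin N → ℝ} (hf : Monotone f) {v : ℝ} {j : ℕ} :
    (v : EReal) < levelValue f j ↔ #{k | f k ≤ v} ≤ j := by
  unfold levelValue
  split_ifs with hj
  · rw [EReal.coe_lt_coe_iff, ← not_iff_not, not_lt, not_le]
    exact (Tuple.lt_card_le_iff_apply_le_of_monotone (j := ⟨j, hj⟩) hf).symm
  · exact iff_of_true (EReal.coe_lt_top v)
      ((card_le_univ _).trans ((Fintype.card_fin N).trans_le (not_lt.1 hj)))

theorem extDist_coe_coe (a b : ℝ) : extDist a b = edist a b := by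
  unfold extDist
  split_ifs with h
  · rw [EReal.coe_injective h, edist_self]
  · rw [← EReal.coe_sub, EReal.abs_def, edist_dist, Real.dist_eq]

theorem extDist_levelValue_le {N : ℕ} (f f' : Fin N → ℝ) (j : ℕ) :
    extDist (levelValue f j) (levelValue f' j) ≤ edist f f' := by
  unfold levelValue
  split_ifs with hj
  · exact (extDist_coe_coe _ _).trans_le (edist_le_pi_edist f f' ⟨j, hj⟩)
  · simp [extDist]

section Sublevel

variable {P : Type*} {ρ : Set P → Set P → ℕ} {g g' : P → ℝ}

theorem setOf_le_eq_initialSegment {N : ℕ} {e : Fin N ≃ P} (hg : Monotone (g ∘ e)) (u : ℝ) :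
    {x | g x ≤ u} = initialSegment e #{k | (g ∘ e) k ≤ u} := by
  ext x
  obtain ⟨k, rfl⟩ := e.surjective x
  rw [initialSegment, Set.mem_ofPred_eq, Set.mem_ofPred_eq, e.symm_apply_apply]
  exact (Tuple.lt_card_le_iff_apply_le_of_monotone hg).symm

theorem IsRankFunction.exists_isBarcode_sublevelRank (hρ : IsRankFunction ρ) {N : ℕ}
    (e : Fin N ≃ P) :
    ∃ (ι : Type) (_ : Fintype ι) (p : ι → Fin N) (q : ι → ℕ), ∀ g : P → ℝ, Monotone (g ∘ e) →
      IsBarcode (sublevelRank ρ g) (fun x => (g ∘ e) (p x)) fun x => levelValue (g ∘ e) (q x) := by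
  obtain ⟨ι, hι, p, q, hpq, hcount⟩ :=
    hρ.exists_bars (initialSegment_mono e) (by ext; simp [initialSegment]) N
  refine ⟨ι, hι, p, q, fun g hg => ⟨fun x => ?_, fun u v huv => ?_⟩⟩
  · unfold levelValue
    split_ifs with hq
    · exact EReal.coe_le_coe_iff.2 (hg (hpq x).le)
    · exact le_top
  · have hle : #{k | (g ∘ e) k ≤ u} ≤ #{k | (g ∘ e) k ≤ v} :=
      card_le_card (monotone_filter_right _ fun _ _ hk => hk.trans huv.le)
    rw [sublevelRank, if_pos huv, setOf_le_eq_initialSegment hg, setOf_le_eq_initialSegment hg,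
      hcount _ _ hle ((card_le_univ _).trans_eq (Fintype.card_fin N))]
    simp only [coe_lt_levelValue_iff hg, Tuple.lt_card_le_iff_apply_le_of_monotone hg]

theorem eventually_refines [Finite P] (g : P → ℝ) :
    ∀ᶠ g' in 𝓝 g, ∀ x y, g' x ≤ g' y → g x ≤ g y := by
  refine eventually_all.2 fun x => eventually_all.2 fun y => ?_
  rcases le_or_gt (g x) (g y) with hle | hlt
  · exact Eventually.of_forall fun _ _ => hle
  · filter_upwards [(continuous_apply y).tendsto g |>.eventually_lt
      ((continuous_apply x).tendsto g) hlt] with g' hlt' hle'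
    exact absurd hle' hlt'.not_ge

variable [Fintype P]

theorem IsRankFunction.bottleneckDist_sublevelRank_le_of_monotone (hρ : IsRankFunction ρ) {N : ℕ}
    (e : Fin N ≃ P) (hg : Monotone (g ∘ e)) (hg' : Monotone (g' ∘ e)) :
    bottleneckDist (sublevelRank ρ g) (sublevelRank ρ g') ≤ edist g g' := by
  have hedist : edist (g ∘ e) (g' ∘ e) ≤ edist g g' :=
    edist_pi_le_iff.2 fun k => edist_le_pi_edist g g' (e k)
  obtain ⟨ι, hι, p, q, hbar⟩ := hρ.exists_isBarcode_sublevelRank e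
  refine (hbar g hg).bottleneckDist_le (hbar g' hg') fun x => (min_le_left _ _).trans ?_
  refine (max_le ?_ (extDist_levelValue_le _ _ (q x))).trans hedist
  exact (extDist_coe_coe _ _).trans_le (edist_le_pi_edist (g ∘ e) (g' ∘ e) (p x))

theorem IsRankFunction.bottleneckDist_sublevelRank_le_of_refines (hρ : IsRankFunction ρ)
    (h : ∀ x y, g' x ≤ g' y → g x ≤ g y) :
    bottleneckDist (sublevelRank ρ g) (sublevelRank ρ g') ≤ edist g g' ∧
      bottleneckDist (sublevelRank ρ g') (sublevelRank ρ g) ≤ edist g' g := by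
  let e₀ := (Fintype.equivFin P).symm
  let e := (Tuple.sort (g' ∘ e₀)).trans e₀
  have hg' : Monotone (g' ∘ e) := Tuple.monotone_sort (g' ∘ e₀)
  have hg : Monotone (g ∘ e) := fun _ _ hij => h _ _ (hg' hij)
  exact ⟨hρ.bottleneckDist_sublevelRank_le_of_monotone e hg hg',
    hρ.bottleneckDist_sublevelRank_le_of_monotone e hg' hg⟩

theorem IsRankFunction.bottleneckDist_sublevelRank_le (hρ : IsRankFunction ρ) (g g' : P → ℝ) :
    bottleneckDist (sublevelRank ρ g) (sublevelRank ρ g') ≤ edist g g' :=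
  le_edist_of_eventually_le_edist
    (d := fun g₁ g₂ => bottleneckDist (sublevelRank ρ g₁) (sublevelRank ρ g₂))
    (fun _ _ _ => bottleneckDist_triangle _ _ _)
    (fun g₁ => (eventually_refines g₁).mono fun _ =>
      hρ.bottleneckDist_sublevelRank_le_of_refines)
    g g'

end Sublevel

end Stability

/-! ### Persistent homology of filtered complexes -/

section HomologyRank

variable (F : Type*) [Field F] {V : Type*}

/-- The rank of `Hₙ(K; F) → Hₙ(L; F)` if `K` is a subcomplex of `L`. -/
def homologyRank (n : ℕ) (K L : PreAbstractSimplicialComplex V) : ℕ :=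
  relRank F (cycles F K n) (boundaries F L n)

theorem finrank_range_homologyMap {K L : PreAbstractSimplicialComplex V} (h : K ≤ L) (n : ℕ) :
    Module.finrank F (LinearMap.range (homologyMap F h n)) = homologyRank F n K L := by
  let φ := homologyMap F h n ∘ₗ Submodule.mkQ _
  have hrange : LinearMap.range φ = LinearMap.range (homologyMap F h n) :=
    LinearMap.range_comp_of_range_eq_top _ (Submodule.range_mkQ _)
  have hker : LinearMap.ker φ = (boundaries F L n).submoduleOf (cycles F K n) := by
    ext x
    exact Submodule.Quotient.mk_eq_zero _
  rw [← hrange, homologyRank, relRank, ← hker]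
  exact φ.quotKerEquivRange.finrank_eq.symm

theorem pbn_eq_homologyRank (X : FilteredComplex V) (r : ℕ) (u v : ℝ) :
    pbn F X r u v = if u < v then homologyRank F r (X.sublevel u) (X.sublevel v) else 0 := by
  unfold pbn
  split_ifs with huv
  · exact finrank_range_homologyMap F _ r
  · rfl

theorem chains_bot (n : ℕ) : chains F (⊥ : PreAbstractSimplicialComplex V) n = ⊥ := by
  have hempty : {x : Fin (n + 1) → V |
      ∃ σ ∈ (⊥ : PreAbstractSimplicialComplex V), ∀ i, x i ∈ σ} = ∅ :=
    Set.eq_empty_of_forall_notMem fun _ ⟨_, hσ, _⟩ => hσ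
  rw [chains, hempty]
  exact Finsupp.supported_empty

theorem cycles_bot (n : ℕ) : cycles F (⊥ : PreAbstractSimplicialComplex V) n = ⊥ := by
  cases n with
  | zero => exact chains_bot F 0
  | succ n => rw [cycles, chains_bot, bot_inf_eq]

instance [Finite V] (n : ℕ) : Module.Finite F (TupleSpace F V n) :=
  inferInstanceAs (Module.Finite F ((Fin n → V) →₀ F))

theorem isRankFunction_homologyRank [Finite V] (n : ℕ) :
    IsRankFunction (homologyRank F (V := V) n) where
  bot_left L := by rw [homologyRank, cycles_bot, relRank_bot_left]
  mono_left _ _ hK L := relRank_mono_left (cycles_mono F hK n) _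
  add_le_add _ _ hK _ _ hL := relRank_add_relRank_le (cycles_mono F hK n) (boundaries_mono F hL n)

end HomologyRank

section Pullback

variable {F : Type*} [Field F] {V V' : Type*}

variable (F) in
/-- The linear map which applies `φ` to every entry of a tuple. -/
def tupleMap (φ : V → V') (n : ℕ) : TupleSpace F V n →ₗ[F] TupleSpace F V' n :=
  Finsupp.lmapDomain F F fun x : Fin n → V => φ ∘ x

theorem tupleMap_injective {φ : V → V'} (hφ : Function.Injective φ) (n : ℕ) :
    Function.Injective (tupleMap F φ n) :=
  Finsupp.mapDomain_injective hφ.comp_left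

theorem boundary_comp_tupleMap (φ : V → V') (n : ℕ) :
    boundary F V' n ∘ₗ tupleMap F φ (n + 1) = tupleMap F φ n ∘ₗ boundary F V n := by
  refine Finsupp.lhom_ext' fun x => LinearMap.ext_ring ?_
  change Finsupp.linearCombination F _ (Finsupp.mapDomain _ (Finsupp.single x 1))
    = Finsupp.lmapDomain F F _ (Finsupp.linearCombination F _ (Finsupp.single x 1))
  simp only [Finsupp.mapDomain_single, Finsupp.linearCombination_single, one_smul]
  refine Eq.trans ?_ (map_sum (Finsupp.lmapDomain F F (φ ∘ · : (Fin n → V) → Fin n → V')) _ _).symm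
  simp only [Finsupp.lmapDomain_apply, Finsupp.mapDomain_single]
  rfl

/-- The complex of the sets whose image under `e` is a simplex of `K`. -/
def preimageComplex (e : V ↪ V') (K : PreAbstractSimplicialComplex V') :
    PreAbstractSimplicialComplex V where
  faces := {σ | σ.map e ∈ K}
  isRelLowerSet_faces := fun _ hσ =>
    ⟨Finset.map_nonempty.1 (K.isRelLowerSet_faces hσ).1, fun _ hτσ hτ =>
      (K.isRelLowerSet_faces hσ).2 (Finset.map_subset_map.2 hτσ) hτ.map⟩

/-- The filtered complex `preimageComplex e Y.complex`, with the values of the images. -/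
def FilteredComplex.comap (e : V ↪ V') (Y : FilteredComplex V') : FilteredComplex V where
  complex := preimageComplex e Y.complex
  value σ := Y.value (σ.map e)
  mono _ hσ _ hτ hτσ := Y.mono _ hσ _ hτ (Finset.map_subset_map.2 hτσ)

variable (e : V ≃ V') (K L : PreAbstractSimplicialComplex V') (n : ℕ)

theorem map_chains_preimageComplex :
    (chains F (preimageComplex e.toEmbedding K) n).map (tupleMap F e (n + 1)) = chains F K n := by
  refine (Finsupp.lmapDomain_supported F F _ _).trans (congrArg (Finsupp.supported F F) ?_)
  ext y
  constructor
  · rintro ⟨x, ⟨σ, hσ, hx⟩, rfl⟩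
    exact ⟨_, hσ, fun i => Finset.mem_map_of_mem _ (hx i)⟩
  · rintro ⟨σ, hσ, hy⟩
    refine ⟨e.symm ∘ y, ⟨σ.map e.symm.toEmbedding, ?_, fun i => Finset.mem_map_of_mem _ (hy i)⟩,
      funext fun i => e.apply_symm_apply (y i)⟩
    change (σ.map e.symm.toEmbedding).map e.toEmbedding ∈ K
    simpa [Finset.map_map] using hσ

theorem map_cycles_preimageComplex :
    (cycles F (preimageComplex e.toEmbedding K) n).map (tupleMap F e (n + 1)) = cycles F K n := by
  cases n with
  | zero => exact map_chains_preimageComplex e K 0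
  | succ n =>
    rw [cycles, cycles, ← map_chains_preimageComplex e, Submodule.map_inf_eq_map_inf_comap,
      ← LinearMap.ker_comp, boundary_comp_tupleMap, LinearMap.ker_comp_of_ker_eq_bot]
    exact LinearMap.ker_eq_bot.2 (tupleMap_injective e.injective _)

theorem map_boundaries_preimageComplex :
    (boundaries F (preimageComplex e.toEmbedding K) n).map (tupleMap F e (n + 1)) =
      boundaries F K n := by
  rw [boundaries, boundaries, ← map_chains_preimageComplex e, ← Submodule.map_comp,
    ← Submodule.map_comp, boundary_comp_tupleMap]

theorem homologyRank_preimageComplex :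
    homologyRank F n (preimageComplex e.toEmbedding K) (preimageComplex e.toEmbedding L) =
      homologyRank F n K L := by
  rw [homologyRank, homologyRank, ← map_cycles_preimageComplex e,
    ← map_boundaries_preimageComplex e, relRank_map (tupleMap_injective e.injective _)]

theorem pbn_comap (Y : FilteredComplex V') : pbn F (Y.comap e.toEmbedding) n = pbn F Y n := by
  ext u v
  rw [pbn_eq_homologyRank, pbn_eq_homologyRank, ← homologyRank_preimageComplex e]
  rfl

end Pullback

section ShiftedMap

variable {F : Type*} [Field F] {V V' : Type*}

theorem IsRankFunction.comp {α γ : Type*} [Preorder α] [OrderBot α] [Preorder γ] [OrderBot γ]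
    {ρ : α → α → ℕ} (hρ : IsRankFunction ρ) {φ : γ → α} (hφ : Monotone φ) (hbot : φ ⊥ = ⊥) :
    IsRankFunction fun a b => ρ (φ a) (φ b) where
  bot_left b := by rw [hbot, hρ.bot_left]
  mono_left _ _ ha b := hρ.mono_left (hφ ha) (φ b)
  add_le_add _ _ ha _ _ hb := hρ.add_le_add (hφ ha) (hφ hb)

/-- The smallest complex which contains the nonempty members of `A`. -/
def generatedComplex (A : Set (Finset V)) : PreAbstractSimplicialComplex V where
  faces := {τ | τ.Nonempty ∧ ∃ σ ∈ A, τ ⊆ σ}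
  isRelLowerSet_faces := fun _ ⟨hτ, σ, hσ, hτσ⟩ =>
    ⟨hτ, fun _ hυτ hυ => ⟨hυ, σ, hσ, hυτ.trans hτσ⟩⟩

theorem generatedComplex_mono : Monotone (generatedComplex (V := V)) :=
  fun _ _ hAB _ ⟨hτ, σ, hσ, hτσ⟩ => ⟨hτ, σ, hAB hσ, hτσ⟩

theorem generatedComplex_empty : generatedComplex (∅ : Set (Finset V)) = ⊥ :=
  bot_unique fun _ ⟨_, _, hσ, _⟩ => hσ

theorem generatedComplex_coe (K : PreAbstractSimplicialComplex V) :
    generatedComplex (K : Set (Finset V)) = K :=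
  le_antisymm (fun _ ⟨hτ, _, hσ, hτσ⟩ => (K.isRelLowerSet_faces hσ).2 hτσ hτ)
    fun σ hσ => ⟨(K.isRelLowerSet_faces hσ).1, σ, hσ, subset_rfl⟩

theorem pbn_eq_sublevelRank (X : FilteredComplex V) {T : Set (Finset V)}
    (hT : ∀ σ, σ ∈ T ↔ σ ∈ X.complex ∧ X.value σ ≠ ⊤) {g : T → ℝ} (hg : ∀ σ : T, X.value σ = g σ)
    (r : ℕ) :
    pbn F X r = sublevelRank (fun A B : Set T => homologyRank F r
      (generatedComplex (Subtype.val '' A)) (generatedComplex (Subtype.val '' B))) g := by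
  have hsub (u : ℝ) : generatedComplex (Subtype.val '' {σ : T | g σ ≤ u}) = X.sublevel u := by
    rw [← generatedComplex_coe (X.sublevel u)]
    congr 1
    ext σ
    constructor
    · rintro ⟨σ, hσ, rfl⟩
      exact ⟨((hT σ).1 σ.2).1, (hg σ).trans_le (EReal.coe_le_coe_iff.2 hσ)⟩
    · rintro ⟨hσ, hu⟩
      have hσT : σ ∈ T := (hT σ).2 ⟨hσ, ne_top_of_le_ne_top (EReal.coe_ne_top u) hu⟩
      exact ⟨⟨σ, hσT⟩, EReal.coe_le_coe_iff.1 ((hg ⟨σ, hσT⟩).symm.trans_le hu), rfl⟩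
  ext u v
  rw [pbn_eq_homologyRank, sublevelRank, hsub, hsub]

/-- The map of vertices `e` sends simplices of `X` to simplices of `Y` and raises their values by
at most `c`. -/
def IsShiftedMap (c : ℝ≥0) (e : V ↪ V') (X : FilteredComplex V) (Y : FilteredComplex V') : Prop :=
  ∀ σ ∈ X.complex, σ.map e ∈ Y.complex ∧ Y.value (σ.map e) ≤ X.value σ + (c : ℝ)

theorem ne_top_iff_of_extDist_le {a b : EReal} {c : ℝ≥0} (h : extDist a b ≤ c) :
    a ≠ ⊤ ↔ b ≠ ⊤ := by
  obtain ⟨hab, hba⟩ := extDist_le_coe_iff.1 h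
  exact ⟨fun ha => ne_top_of_le_ne_top (EReal.add_ne_top ha (EReal.coe_ne_top _)) hba,
    fun hb => ne_top_of_le_ne_top (EReal.add_ne_top hb (EReal.coe_ne_top _)) hab⟩

theorem ne_bot_of_extDist_le {a b : EReal} {c : ℝ≥0} (h : extDist a b ≤ c) (ha : a ≠ ⊥) :
    b ≠ ⊥ := by
  rintro rfl
  exact ha (le_bot_iff.1 ((extDist_le_coe_iff.1 h).1.trans_eq (EReal.bot_add _)))

theorem bottleneckDist_pbn_le_of_extDist_le [Finite V] {X Y : FilteredComplex V} {c : ℝ≥0}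
    (hcomplex : ∀ σ, σ ∈ X.complex ↔ σ ∈ Y.complex)
    (hdist : ∀ σ ∈ X.complex, extDist (X.value σ) (Y.value σ) ≤ c)
    (hbot : ∀ σ ∈ X.complex, X.value σ ≠ ⊥) (r : ℕ) :
    bottleneckDist (pbn F X r) (pbn F Y r) ≤ c := by
  let T : Set (Finset V) := {σ | σ ∈ X.complex ∧ X.value σ ≠ ⊤}
  have hTY (σ) : σ ∈ T ↔ σ ∈ Y.complex ∧ Y.value σ ≠ ⊤ := by
    rw [← hcomplex]
    exact and_congr_right fun hσ => ne_top_iff_of_extDist_le (hdist σ hσ)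
  have hX (σ : T) : X.value σ = (X.value σ).toReal :=
    (EReal.coe_toReal σ.2.2 (hbot σ σ.2.1)).symm
  have hY (σ : T) : Y.value σ = (Y.value σ).toReal :=
    (EReal.coe_toReal ((hTY σ).1 σ.2).2
      (ne_bot_of_extDist_le (hdist σ σ.2.1) (hbot σ σ.2.1))).symm
  have hrank := (isRankFunction_homologyRank F (V := V) r).comp
    (φ := fun A : Set T => generatedComplex (Subtype.val '' A))
    (generatedComplex_mono.comp Set.monotone_image)
    ((congrArg generatedComplex (Set.image_empty _)).trans generatedComplex_empty)
  have := Fintype.ofFinite T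
  rw [pbn_eq_sublevelRank X (T := T) (fun _ => Iff.rfl) hX, pbn_eq_sublevelRank Y hTY hY]
  refine (hrank.bottleneckDist_sublevelRank_le _ _).trans (edist_pi_le_iff.2 fun σ => ?_)
  rw [← extDist_coe_coe, ← hX, ← hY]
  exact hdist σ σ.2.1

theorem bottleneckDist_pbn_le [Finite V] {X : FilteredComplex V} {Y : FilteredComplex V'}
    {c : ℝ≥0} {e : V ≃ V'} (he : IsShiftedMap c e.toEmbedding X Y)
    (he' : IsShiftedMap c e.symm.toEmbedding Y X) (hbot : ∀ σ ∈ X.complex, X.value σ ≠ ⊥) (r : ℕ) :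
    bottleneckDist (pbn F X r) (pbn F Y r) ≤ c := by
  have hsymm (σ : Finset V) : (σ.map e.toEmbedding).map e.symm.toEmbedding = σ := by
    simp [Finset.map_map]
  rw [← pbn_comap e]
  refine bottleneckDist_pbn_le_of_extDist_le (fun σ => ⟨fun hσ => (he σ hσ).1, fun hσ => ?_⟩)
    (fun σ hσ => extDist_le_coe_iff.2 ⟨?_, (he σ hσ).2⟩) hbot r
  · exact hsymm σ ▸ (he' _ hσ).1
  · exact (congrArg X.value (hsymm σ)).symm.trans_le (he' _ (he σ hσ).1).2

end ShiftedMap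

/-! ### Complexes of weighted graphs -/

section Graph

theorem iInf_coe_le_iInf_coe_add {ι ι' : Type*} {c : ℝ} {x : ι → ℝ} {x' : ι' → ℝ}
    {p : ι → Prop} {p' : ι' → Prop} (h : ∀ i, p i → ∃ i', p' i' ∧ x' i' ≤ x i + c) :
    ⨅ (i') (_ : p' i'), (x' i' : EReal) ≤ (⨅ (i) (_ : p i), (x i : EReal)) + c := by
  rw [← EReal.sub_le_iff_le_add (by simp) (by simp)]
  refine le_iInf₂ fun i hi => ?_
  obtain ⟨i', hi', hle⟩ := h i hi
  rw [EReal.sub_le_iff_le_add (by simp) (by simp), ← EReal.coe_add]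
  exact iInf₂_le_of_le i' hi' (EReal.coe_le_coe_iff.2 hle)

variable {V V' : Type*} {G : SimpleGraph V} {G' : SimpleGraph V'} {f : G.edgeSet → ℝ}
  {f' : G'.edgeSet → ℝ}

section Hom

variable {φ : G →g G'} {H : G.Subgraph} {H' : G'.Subgraph} {S : Set V}

theorem image_closedNeighborhood_subset (h : H.map φ ≤ H') (v : V) :
    φ '' closedNeighborhood H v ⊆ closedNeighborhood H' (φ v) := by
  rintro _ ⟨w, rfl | hw, rfl⟩
  · exact Set.mem_insert _ _
  · exact Set.mem_insert_of_mem _ (h.2 ⟨v, w, hw, rfl, rfl⟩)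

theorem InNeighborhood.image (h : H.map φ ≤ H') (hS : InNeighborhood H S) :
    InNeighborhood H' (φ '' S) := by
  obtain ⟨w, hw, hSw⟩ := hS
  exact ⟨φ w, h.1 ⟨w, hw, rfl⟩, (Set.image_mono hSw).trans (image_closedNeighborhood_subset h w)⟩

theorem IsEnclaveless.image (hφ : Function.Injective φ) (h : H.map φ ≤ H')
    (hS : IsEnclaveless H S) : IsEnclaveless H' (φ '' S) := by
  refine ⟨(Set.image_mono hS.1).trans h.1, ?_⟩
  rintro _ ⟨v, hv, rfl⟩ hN
  exact hS.2 v hv ((Set.image_subset_image_iff hφ).1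
    ((image_closedNeighborhood_subset h v).trans hN))

variable {c : ℝ}

theorem map_sublevelGraph_le (hf : ∀ e, f' (φ.mapEdgeSet e) ≤ f e + c) (t : ℝ) :
    (sublevelGraph G f t).map φ ≤ sublevelGraph G' f' (t + c) := by
  have hshift {e : G.edgeSet} (he : f e ≤ t) : f' (φ.mapEdgeSet e) ≤ t + c :=
    (hf e).trans (add_le_add_left he c)
  constructor
  · rintro _ ⟨v, ⟨e, he, hv⟩, rfl⟩
    exact ⟨φ.mapEdgeSet e, hshift he, Sym2.mem_map.2 ⟨v, hv, rfl⟩⟩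
  · rintro _ _ ⟨u, v, ⟨huv, he⟩, rfl, rfl⟩
    exact ⟨φ.map_adj huv, hshift he⟩

theorem vertexValue_map_le (hf : ∀ e, f' (φ.mapEdgeSet e) ≤ f e + c) (v : V) :
    vertexValue G' f' (φ v) ≤ vertexValue G f v + c :=
  iInf_coe_le_iInf_coe_add fun e hv => ⟨φ.mapEdgeSet e, Sym2.mem_map.2 ⟨v, hv, rfl⟩, hf e⟩

end Hom

theorem vertexValue_ne_bot (hf : BddBelow (Set.range f)) (v : V) : vertexValue G f v ≠ ⊥ := by
  obtain ⟨m, hm⟩ := hf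
  exact ne_bot_of_le_ne_bot (EReal.coe_ne_bot m)
    (le_iInf₂ fun e _ => EReal.coe_le_coe_iff.2 (hm ⟨e, rfl⟩))

theorem simplexValue_singleton (f : G.edgeSet → ℝ) (g : Finset V → EReal) (v : V) :
    simplexValue G f g {v} = vertexValue G f v := by
  simp [simplexValue]

section Embedding

variable {φ : G ↪g G'}

theorem simplexValue_map_le {c : ℝ} (hf : ∀ e, f' (φ.mapEdgeSet e) ≤ f e + c)
    {g : Finset V → EReal} {g' : Finset V' → EReal} {σ : Finset V}
    (hg : g' (σ.map φ.toEmbedding) ≤ g σ + c) :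
    simplexValue G' f' g' (σ.map φ.toEmbedding) ≤ simplexValue G f g σ + c := by
  by_cases h : σ.card = 1
  · obtain ⟨v, rfl⟩ := Finset.card_eq_one.1 h
    rw [Finset.map_singleton, simplexValue_singleton, simplexValue_singleton]
    exact vertexValue_map_le (φ := φ.toHom) hf v
  · rwa [simplexValue, simplexValue, Finset.card_map, if_neg h, if_neg h]

theorem exists_mapEdgeSet_eq {e' : G'.edgeSet} {σ : Finset V}
    (he' : ∀ v ∈ e'.1, v ∈ σ.map φ.toEmbedding) :
    ∃ e : G.edgeSet, φ.mapEdgeSet e = e' ∧ ∀ v ∈ e.1, v ∈ σ := by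
  obtain ⟨⟨u', v'⟩, hadj⟩ := e'
  obtain ⟨u, hu, rfl⟩ := Finset.mem_map.1 (he' u' (Sym2.mem_mk_left _ _))
  obtain ⟨v, hv, rfl⟩ := Finset.mem_map.1 (he' v' (Sym2.mem_mk_right _ _))
  refine ⟨⟨s(u, v), φ.map_adj_iff.1 hadj⟩, rfl, fun w hw => ?_⟩
  rcases Sym2.mem_iff.1 hw with rfl | rfl <;> assumption

section Value

variable {c : ℝ} (hf : ∀ e, f' (φ.mapEdgeSet e) ≤ f e + c)
include hf

theorem cliqueValue_map_le (σ : Finset V) :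
    cliqueValue G' f' (σ.map φ.toEmbedding) ≤ cliqueValue G f σ + c := by
  refine simplexValue_map_le hf (iSup₂_le fun e' he' => ?_)
  obtain ⟨e, rfl, he⟩ := exists_mapEdgeSet_eq he'
  calc (f' (φ.mapEdgeSet e) : EReal) ≤ f e + c := EReal.coe_le_coe_iff.2 (hf e)
    _ ≤ _ := add_le_add_left (le_iSup₂ (f := fun (e : G.edgeSet) _ => (f e : EReal)) e he) _

theorem neighborhoodValue_map_le (σ : Finset V) :
    neighborhoodValue G' f' (σ.map φ.toEmbedding) ≤ neighborhoodValue G f σ + c := by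
  refine simplexValue_map_le hf (iInf_coe_le_iInf_coe_add fun t ht => ⟨t + c, ?_, le_rfl⟩)
  rw [Finset.coe_map]
  exact ht.image (map_sublevelGraph_le (φ := φ.toHom) hf t)

theorem enclavelessValue_map_le (σ : Finset V) :
    enclavelessValue G' f' (σ.map φ.toEmbedding) ≤ enclavelessValue G f σ + c := by
  refine simplexValue_map_le hf
    (iInf_coe_le_iInf_coe_add fun t ⟨S, hσS, hS⟩ => ⟨t + c, ⟨φ '' S, ?_, ?_⟩, le_rfl⟩)
  · rw [Finset.coe_map]
    exact Set.image_mono hσS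
  · exact hS.image (φ := φ.toHom) φ.injective (map_sublevelGraph_le hf t)

end Value

section Shift

variable {c : ℝ≥0} (hf : ∀ e, f' (φ.mapEdgeSet e) ≤ f e + c)
include hf

theorem isShiftedMap_cliqueFiltered :
    IsShiftedMap c φ.toEmbedding (cliqueFiltered G f) (cliqueFiltered G' f') := by
  refine fun σ hσ => ⟨⟨hσ.1.map, ?_⟩, cliqueValue_map_le hf σ⟩
  rw [Finset.coe_map]
  rintro _ ⟨u, hu, rfl⟩ _ ⟨v, hv, rfl⟩ huv
  exact φ.map_adj_iff.2 (hσ.2 hu hv (ne_of_apply_ne _ huv))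

theorem isShiftedMap_neighborhoodFiltered :
    IsShiftedMap c φ.toEmbedding (neighborhoodFiltered G f) (neighborhoodFiltered G' f') := by
  refine fun σ hσ => ⟨⟨hσ.1.map, ?_⟩, neighborhoodValue_map_le hf σ⟩
  rw [Finset.coe_map]
  exact hσ.2.image (φ := φ.toHom) le_top

theorem isShiftedMap_enclavelessFiltered :
    IsShiftedMap c φ.toEmbedding (enclavelessFiltered G f) (enclavelessFiltered G' f') := by
  refine fun σ hσ => ⟨⟨hσ.1.map, ?_⟩, enclavelessValue_map_le hf σ⟩
  rw [Finset.coe_map]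
  exact hσ.2.image (φ := φ.toHom) φ.injective le_top

end Shift

end Embedding

theorem FilteredComplex.value_ne_bot {X : FilteredComplex V} (h : ∀ v, X.value {v} ≠ ⊥)
    {σ : Finset V} (hσ : σ ∈ X.complex) : X.value σ ≠ ⊥ := by
  obtain ⟨⟨v, hv⟩, hface⟩ := X.complex.isRelLowerSet_faces hσ
  have hvσ : {v} ⊆ σ := Finset.singleton_subset_iff.2 hv
  exact ne_bot_of_le_ne_bot (h v) (X.mono σ hσ {v} (hface hvσ (Finset.singleton_nonempty v)) hvσ)

theorem bottleneckDist_pbn_le_naturalPseudodist {F : Type*} [Field F] [Finite V]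
    {X : FilteredComplex V} {Y : FilteredComplex V'}
    (hX : ∃ g, X.value = simplexValue G f g)
    (hXY : ∀ {φ : G ↪g G'} {c : ℝ≥0}, (∀ e, f' (φ.mapEdgeSet e) ≤ f e + c) →
      IsShiftedMap c φ.toEmbedding X Y)
    (hYX : ∀ {φ : G' ↪g G} {c : ℝ≥0}, (∀ e, f (φ.mapEdgeSet e) ≤ f' e + c) →
      IsShiftedMap c φ.toEmbedding Y X) (r : ℕ) :
    bottleneckDist (pbn F X r) (pbn F Y r) ≤ naturalPseudodist G f G' f' := by
  refine le_iInf fun ψ => ?_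
  cases hc : ⨆ e, ENNReal.ofReal |f e - f' (ψ.mapEdgeSet e)| with
  | top => exact le_top
  | coe c =>
    have hdist (e : G.edgeSet) : |f e - f' (ψ.mapEdgeSet e)| ≤ c :=
      ENNReal.ofReal_le_coe.1
        ((le_iSup (fun e => ENNReal.ofReal |f e - f' (ψ.mapEdgeSet e)|) e).trans hc.le)
    refine bottleneckDist_pbn_le (e := ψ.toEquiv)
      (hXY (φ := ψ.toEmbedding) fun e => ?_) (hYX (φ := ψ.symm.toEmbedding) fun e' => ?_)
      (fun σ => X.value_ne_bot fun v => ?_) r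
    · exact sub_le_iff_le_add'.1 (abs_sub_le_iff.1 (hdist e)).2
    · obtain ⟨e, rfl⟩ := ψ.mapEdgeSet.surjective e'
      change f (ψ.mapEdgeSet.symm (ψ.mapEdgeSet e)) ≤ _
      rw [ψ.mapEdgeSet.symm_apply_apply]
      exact sub_le_iff_le_add'.1 (abs_sub_le_iff.1 (hdist e)).1
    · obtain ⟨g, hg⟩ := hX
      rw [hg, simplexValue_singleton]
      exact vertexValue_ne_bot (Set.finite_range f).bddBelow v

end Graph

end GraphPersistence

end

open GraphPersistence in
theorem mainTheorem2 {F : Type*} [Field F] {V V' : Type*} [Finite V] [Finite V']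
    (G : SimpleGraph V) (f : G.edgeSet → ℝ) (G' : SimpleGraph V') (f' : G'.edgeSet → ℝ) (r : ℕ) :
    GraphPersistence.bottleneckDist
        (GraphPersistence.pbn F (GraphPersistence.cliqueFiltered G f) r)
        (GraphPersistence.pbn F (GraphPersistence.cliqueFiltered G' f') r)
      ≤ GraphPersistence.naturalPseudodist G f G' f' ∧
    GraphPersistence.bottleneckDist
        (GraphPersistence.pbn F (GraphPersistence.neighborhoodFiltered G f) r)
        (GraphPersistence.pbn F (GraphPersistence.neighborhoodFiltered G' f') r)
      ≤ GraphPersistence.naturalPseudodist G f G' f' ∧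
    GraphPersistence.bottleneckDist
        (GraphPersistence.pbn F (GraphPersistence.enclavelessFiltered G f) r)
        (GraphPersistence.pbn F (GraphPersistence.enclavelessFiltered G' f') r)
      ≤ GraphPersistence.naturalPseudodist G f G' f' :=
  ⟨bottleneckDist_pbn_le_naturalPseudodist ⟨_, rfl⟩
      isShiftedMap_cliqueFiltered isShiftedMap_cliqueFiltered r,
    bottleneckDist_pbn_le_naturalPseudodist ⟨_, rfl⟩
      isShiftedMap_neighborhoodFiltered isShiftedMap_neighborhoodFiltered r,
    bottleneckDist_pbn_le_naturalPseudodist ⟨_, rfl⟩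
      isShiftedMap_enclavelessFiltered isShiftedMap_enclavelessFiltered r⟩
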